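/- Let $\mathbb X$ be a standard Borel space and $\Theta$ a separable metrizable space whose Borel sigma-field $\mathcal B(\Theta)$ is standard Borel (for instance, Polish spaces or Borel subsets of Euclidean spaces). Let $\mu$ be a sigma-finite measure on $\mathbb X$ and let $f:\mathbb X\times\Theta\to[0,\infty)$, $(x,\theta)\mapsto f(x\mid\theta)$, be jointly measurable with $\int_{\mathbb X} f(x\mid\theta)\,d\mu(x)=1$ for every $\theta$. For a measure $H$ on $\Theta$ put $$f_H(x)=\int_\Theta f(x\mid\theta)\,dH(\theta),\qquad dF_H=f_H\,d\mu,\qquad P_H(A\mid x)=\frac{\int_A f(x\mid\theta)\,dH(\theta)}{\int_\Theta f(x\mid\theta)\,dH(\theta)},$$ where $P_H(A\mid x)=0$ if $f_H(x)\in\{0,\infty\}$ (for a probability measure $H$ this is an $F_H$-null set of $x$). Let $G_0$ be a probability measure on $\Theta$ and $\alpha_n\in(0,1)$ for $n\ge 1$. Given $\mathbb X$-valued random variables $X_1,X_2,\dots$ on a probability space with probability $P$, define Newton's recursion $$G_n(\cdot)=(1-\alpha_n)\,G_{n-1}(\cdot)+\alpha_n\,P_{G_{n-1}}(\cdot\mid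 X_n),\qquad n\ge 1 .$$ Let $\theta_1,\theta_2,\dots$ be $\Theta$-valued random variables on the same space such that, for every $n\ge 0$, the conditional law of $\theta_{n+1}$ given $X_1,\dots,X_n$ is $G_n$ (so $\theta_1\sim G_0$), and the conditional law of $X_{n+1}$ given $X_1,\dots,X_n,\theta_{n+1}$ has density $f(\cdot\mid\theta_{n+1})$ with respect to $\mu$. Then there is a random probability measure $G$ on $\Theta$ such that $G_n\to G$ weakly, $P$-almost surely. Moreover, for any such $G$ and every $A\in\mathcal B(\Theta)$, if $$V_{A,n}=\int_{\mathbb X}P_{G_n}(A\mid x)^2\,dF_{G_n}(x)-G_n(A)^2,\qquad V_A=\int_{\{x:\,f_G(x)\ne 0\}}P_G(A\mid x)^2\,dF_G(x)-G(A)^2,$$ then $V_{A,n}\to V_A$ almost surely as $n\to\infty$. -/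

import Mathlib

open MeasureTheory ProbabilityTheory Filter Topology
open scoped NNReal ENNReal BoundedContinuousFunction

namespace NewtonMixture

section Formulas

variable {𝕏 Θ : Type*} [MeasurableSpace 𝕏] [MeasurableSpace Θ]

/-- The mixture density `f_H(x) = ∫ f(x ∣ t) dH(t)`, as an extended nonnegative number. -/
noncomputable def mixDensity (f : 𝕏 → Θ → ℝ≥0) (H : Measure Θ) (x : 𝕏) : ℝ≥0∞ :=
  ∫⁻ t, (f x t : ℝ≥0∞) ∂H

/-- The mixture `F_H`, the measure on the sample space with density `f_H` with respect to `μ`. -/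
noncomputable def mixture (μ : Measure 𝕏) (f : 𝕏 → Θ → ℝ≥0) (H : Measure Θ) : Measure 𝕏 :=
  μ.withDensity (mixDensity f H)

/-- The posterior `P_H(· ∣ x)`, that is `P_H(A ∣ x) = ∫_A f(x ∣ t) dH(t) / ∫ f(x ∣ t) dH(t)`.
At points where the denominator is `0` or `∞` (a null set of `F_H` when `H` is a probability
measure) it is the zero measure. -/
noncomputable def posterior (f : 𝕏 → Θ → ℝ≥0) (H : Measure Θ) (x : 𝕏) : Measure Θ :=
  (mixDensity f H x)⁻¹ • H.withDensity (fun t => (f x t : ℝ≥0∞))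

/-- Newton's recursion along a sequence `x 1, x 2, …` (the value `x 0` is not used):
`G_{n+1} = (1 - α_{n+1}) G_n + α_{n+1} P_{G_n}(· ∣ x_{n+1})`, started at `G₀`. -/
noncomputable def newton (f : 𝕏 → Θ → ℝ≥0) (α : ℕ → ℝ) (G₀ : Measure Θ) (x : ℕ → 𝕏) :
    ℕ → Measure Θ
  | 0 => G₀
  | n + 1 => ENNReal.ofReal (1 - α (n + 1)) • newton f α G₀ x n
      + ENNReal.ofReal (α (n + 1)) • posterior f (newton f α G₀ x n) (x (n + 1))

/-- `∫ P_H(A ∣ x)² dF_H(x) - H(A)²`; with `H = G_n` this is `V_{A,n}`. -/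
noncomputable def plugInVar (μ : Measure 𝕏) (f : 𝕏 → Θ → ℝ≥0) (H : Measure Θ) (A : Set Θ) : ℝ :=
  (∫ x, ((posterior f H x).real A) ^ 2 ∂(mixture μ f H)) - (H.real A) ^ 2

/-- `∫_{f_H ≠ 0} P_H(A ∣ x)² dF_H(x) - H(A)²`; with `H = G` this is `V_A`. -/
noncomputable def limitVar (μ : Measure 𝕏) (f : 𝕏 → Θ → ℝ≥0) (H : Measure Θ) (A : Set Θ) : ℝ :=
  (∫ x in {x | mixDensity f H x ≠ 0}, ((posterior f H x).real A) ^ 2 ∂(mixture μ f H))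
    - (H.real A) ^ 2

end Formulas

theorem posterior_apply {𝕏 Θ : Type*} [MeasurableSpace Θ] (f : 𝕏 → Θ → ℝ≥0) (H : Measure Θ) (x : 𝕏) {A : Set Θ}
    (hA : MeasurableSet A) :
    posterior f H x A = (∫⁻ t in A, (f x t : ℝ≥0∞) ∂H) / ∫⁻ t, (f x t : ℝ≥0∞) ∂H := by
  simp [posterior, mixDensity, withDensity_apply _ hA, ENNReal.div_eq_inv_mul]

section Model

variable {Ω 𝕏 Θ : Type*} [MeasurableSpace Ω] [MeasurableSpace 𝕏] [MeasurableSpace Θ]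

/-- The sigma-field generated by `X_{1:n} = (X_1, …, X_n)`; it is trivial for `n = 0`. -/
abbrev past (X : ℕ → Ω → 𝕏) (n : ℕ) : MeasurableSpace Ω :=
  ⨆ k ∈ Finset.Icc 1 n, MeasurableSpace.comap (X k) inferInstance

/-- The random measure `G_n` computed from the observations `X_1, …, X_n`. -/
noncomputable def newtonAt (f : 𝕏 → Θ → ℝ≥0) (α : ℕ → ℝ) (G₀ : Measure Θ) (X : ℕ → Ω → 𝕏)
    (n : ℕ) (ω : Ω) : Measure Θ :=
  newton f α G₀ (fun k => X k ω) n

/-- Newton's rule read as a probabilistic learning rule for the process `((X_n, θ_n))_{n ≥ 1}`: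
`θ_{n+1} ∣ X_{1:n} ∼ G_n` for `n ≥ 0` (for `n = 0` this says `θ_1 ∼ G₀`), and
`X_{n+1} ∣ X_{1:n}, θ_{n+1}` has density `f(· ∣ θ_{n+1})` with respect to `μ`. Nothing is
assumed on the law of `θ_{n+1}` given `X_{1:n}` and `θ_{1:n}`. -/
structure IsNewtonModel (P : Measure Ω) (μ : Measure 𝕏) (f : 𝕏 → Θ → ℝ≥0) (α : ℕ → ℝ)
    (G₀ : Measure Θ) (X : ℕ → Ω → 𝕏) (θ : ℕ → Ω → Θ) : Prop where
  measurable_X : ∀ n, 1 ≤ n → Measurable (X n)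
  measurable_θ : ∀ n, 1 ≤ n → Measurable (θ n)
  predictive : ∀ (n : ℕ) (A : Set Θ), MeasurableSet A →
    P⟦θ (n + 1) ⁻¹' A | past X n⟧ =ᵐ[P] fun ω => (newtonAt f α G₀ X n ω).real A
  sampling : ∀ (n : ℕ) (B : Set 𝕏), MeasurableSet B →
    P⟦X (n + 1) ⁻¹' B | past X n ⊔ MeasurableSpace.comap (θ (n + 1)) inferInstance⟧
      =ᵐ[P] fun ω => (μ.withDensity (fun x => (f x (θ (n + 1) ω) : ℝ≥0∞))).real B

/-- The random probability measure `G` is the almost sure weak limit of `(G_n)`: almost surely,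
`∫ h dG_n → ∫ h dG` for every bounded continuous `h`. -/
def IsWeakLimit [TopologicalSpace Θ] (P : Measure Ω) (f : 𝕏 → Θ → ℝ≥0) (α : ℕ → ℝ)
    (G₀ : Measure Θ) (X : ℕ → Ω → 𝕏) (G : Kernel Ω Θ) : Prop :=
  ∀ᵐ ω ∂P, ∀ h : Θ →ᵇ ℝ,
    Tendsto (fun n => ∫ t, h t ∂(newtonAt f α G₀ X n ω)) atTop (𝓝 (∫ t, h t ∂(G ω)))

end Model

end NewtonMixture

set_option linter.unusedSectionVars false

namespace NewtonMixture

/-! ### Measurability of mixture densities and posteriors, and the averaging identity for posteriors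
-/

section Formulas

variable {S 𝕏 Θ : Type*} {mS : MeasurableSpace S} [MeasurableSpace 𝕏] [MeasurableSpace Θ]

/-! The posterior averages back to the prior: integrating `P_H(· ∣ x)` against `F_H` returns `H`
(`lintegral_lintegral_posterior`). Under the model, `X_{n+1}` given the past has law `F_{G_n}`, so
`(G_n)` is a measure-valued martingale; the weights `α_n` enter only through convexity.

For each `A`, the bounded martingale `G_n(A)` converges almost surely, with a null set depending on
`A`. The limits have mean `G₀(A)`, and two ordered functions with the same finite integral agree
almost everywhere; this makes the limits continuous along monotone sequences of sets. After
embedding `Θ` in the line, the limits at rational half-lines are therefore almost surely a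
distribution function, which yields a Markov kernel `K` with `G_n(A) → K(A)` almost surely for each
`A` (`exists_kernel_ae_tendsto`). A countable base turns this into weak convergence
(`ae_tendsto_integral`).

Weak convergence alone does not control the variances, since `f(x ∣ ·)` need not be continuous or
bounded. However, `f(x ∣ ·)` is `G₀`-integrable for `μ`-almost every `x`, and the setwise limits
extend to such functions (`ae_tendsto_lintegral`). Hence `f_{G_n}` and the numerators of the
posterior converge `μ`-almost everywhere, and a Scheffé-type argument
(`tendsto_lintegral_of_le_of_lintegral_eq`), with the densities `f_{G_n}` of total mass one as
dominating functions, gives the convergence of `V_{A,n}`. Any other weak limit agrees with `K`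
almost surely. -/

theorem measurable_lintegral_of_le_one {κ : S → Measure Θ} (hκ : Measurable κ)
    (hκ1 : ∀ s, κ s Set.univ ≤ 1) {g : S → Θ → ℝ≥0∞} (hg : Measurable (Function.uncurry g)) :
    Measurable fun s => ∫⁻ t, g s t ∂κ s := by
  let k : Kernel S Θ := ⟨κ, hκ⟩
  have : IsFiniteKernel k := ⟨⟨1, ENNReal.one_lt_top, hκ1⟩⟩
  exact Measurable.lintegral_kernel_prod_right (κ := k) hg

variable {f : 𝕏 → Θ → ℝ≥0}

theorem measurable_density_section (hf : Measurable (Function.uncurry f)) (x : 𝕏) :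
    Measurable fun t => (f x t : ℝ≥0∞) :=
  (hf.comp measurable_prodMk_left).coe_nnreal_ennreal

theorem measurable_mixDensity (hf : Measurable (Function.uncurry f)) {κ : S → Measure Θ}
    (hκ : Measurable κ) (hκ1 : ∀ s, κ s Set.univ ≤ 1) {x : S → 𝕏} (hx : Measurable x) :
    Measurable fun s => mixDensity f (κ s) (x s) :=
  measurable_lintegral_of_le_one hκ hκ1
    (hf.comp ((hx.comp measurable_fst).prodMk measurable_snd)).coe_nnreal_ennreal

theorem measurable_setLIntegral_density (hf : Measurable (Function.uncurry f))
    {κ : S → Measure Θ} (hκ : Measurable κ) (hκ1 : ∀ s, κ s Set.univ ≤ 1) {x : S → 𝕏}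
    (hx : Measurable x) {A : Set Θ} (hA : MeasurableSet A) :
    Measurable fun s => ∫⁻ t in A, (f (x s) t : ℝ≥0∞) ∂κ s := by
  simp_rw [← lintegral_indicator hA]
  refine measurable_lintegral_of_le_one hκ hκ1 ?_
  have := (hf.comp ((hx.comp measurable_fst).prodMk measurable_snd)).coe_nnreal_ennreal.indicator
    (measurable_snd hA : MeasurableSet (Prod.snd ⁻¹' A : Set (S × Θ)))
  exact this

theorem measurable_mixDensity_right (hf : Measurable (Function.uncurry f)) (H : Measure Θ)
    [SFinite H] : Measurable (mixDensity f H) :=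
  hf.coe_nnreal_ennreal.lintegral_prod_right'

theorem measurable_posterior (hf : Measurable (Function.uncurry f)) {κ : S → Measure Θ}
    (hκ : Measurable κ) (hκ1 : ∀ s, κ s Set.univ ≤ 1) {x : S → 𝕏} (hx : Measurable x) :
    Measurable fun s => posterior f (κ s) (x s) := by
  refine Measure.measurable_of_measurable_coe _ fun A hA => ?_
  simp_rw [posterior_apply _ _ _ hA]
  exact (measurable_setLIntegral_density hf hκ hκ1 hx hA).div
    (measurable_mixDensity hf hκ hκ1 hx)

theorem posterior_univ_le_one (f : 𝕏 → Θ → ℝ≥0) (H : Measure Θ) (x : 𝕏) :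
    posterior f H x Set.univ ≤ 1 := by
  rw [posterior_apply _ _ _ MeasurableSet.univ, setLIntegral_univ]
  exact ENNReal.div_self_le_one

theorem lintegral_posterior (hf : Measurable (Function.uncurry f)) (H : Measure Θ) (x : 𝕏)
    {g : Θ → ℝ≥0∞} (hg : Measurable g) :
    ∫⁻ t, g t ∂posterior f H x = (mixDensity f H x)⁻¹ * ∫⁻ t, f x t * g t ∂H := by
  rw [posterior, lintegral_smul_measure,
    lintegral_withDensity_eq_lintegral_mul _ (measurable_density_section hf x) hg]
  rfl

variable {μ : Measure 𝕏}

theorem lintegral_lintegral_density_mul [SigmaFinite μ] (hf : Measurable (Function.uncurry f))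
    (hf1 : ∀ t, ∫⁻ x, (f x t : ℝ≥0∞) ∂μ = 1) (H : Measure Θ) [SFinite H]
    {g : Θ → ℝ≥0∞} (hg : Measurable g) :
    ∫⁻ x, ∫⁻ t, f x t * g t ∂H ∂μ = ∫⁻ t, g t ∂H := by
  rw [lintegral_lintegral_swap
    (hf.coe_nnreal_ennreal.mul (hg.comp measurable_snd)).aemeasurable]
  refine lintegral_congr fun t => ?_
  have ht : Measurable fun x => (f x t : ℝ≥0∞) :=
    (hf.comp measurable_prodMk_right).coe_nnreal_ennreal
  rw [lintegral_mul_const _ ht, hf1, one_mul]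

theorem lintegral_mixDensity [SigmaFinite μ] (hf : Measurable (Function.uncurry f))
    (hf1 : ∀ t, ∫⁻ x, (f x t : ℝ≥0∞) ∂μ = 1) (H : Measure Θ) [SFinite H] :
    ∫⁻ x, mixDensity f H x ∂μ = H Set.univ := by
  simpa [mixDensity] using lintegral_lintegral_density_mul hf hf1 H (g := fun _ => 1)
    measurable_const

theorem ae_mixDensity_lt_top [SigmaFinite μ] (hf : Measurable (Function.uncurry f))
    (hf1 : ∀ t, ∫⁻ x, (f x t : ℝ≥0∞) ∂μ = 1) (H : Measure Θ) [IsFiniteMeasure H] :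
    ∀ᵐ x ∂μ, mixDensity f H x < ∞ :=
  ae_lt_top (measurable_mixDensity_right hf H)
    (by rw [lintegral_mixDensity hf hf1]; exact measure_ne_top _ _)

/-- The density of `F_H` cancels the normalising constant of the posterior, and Tonelli with `∫ f(x
∣ t) dμ(x) = 1` removes the likelihood. This is the source of the martingale property. -/
theorem lintegral_lintegral_posterior [SigmaFinite μ] (hf : Measurable (Function.uncurry f))
    (hf1 : ∀ t, ∫⁻ x, (f x t : ℝ≥0∞) ∂μ = 1) (H : Measure Θ) [IsFiniteMeasure H]
    {g : Θ → ℝ≥0∞} (hg : Measurable g) :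
    ∫⁻ x, ∫⁻ t, g t ∂posterior f H x ∂mixture μ f H = ∫⁻ t, g t ∂H := by
  have hD := measurable_mixDensity_right hf H
  have hN : Measurable fun x => ∫⁻ t, f x t * g t ∂H :=
    (hf.coe_nnreal_ennreal.mul (hg.comp measurable_snd)).lintegral_prod_right'
  have hM : Measurable fun x => (mixDensity f H x)⁻¹ * ∫⁻ t, f x t * g t ∂H := hD.inv.mul hN
  simp_rw [lintegral_posterior hf H _ hg]
  rw [mixture, lintegral_withDensity_eq_lintegral_mul _ hD hM,
    ← lintegral_lintegral_density_mul hf hf1 H hg]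
  refine lintegral_congr_ae ?_
  filter_upwards [ae_mixDensity_lt_top hf hf1 H] with x hx
  simp only [Pi.mul_apply]
  -- Nothing cancels where `f_H(x) = 0`, but there `f(x ∣ ·)` vanishes `H`-almost everywhere, so
  -- both sides are zero.
  rcases eq_or_ne (mixDensity f H x) 0 with h0 | h0
  · rw [h0, zero_mul]
    symm
    refine (lintegral_congr_ae (g := fun _ => 0) ?_).trans lintegral_zero
    have := (lintegral_eq_zero_iff (measurable_density_section hf x)).1 h0
    filter_upwards [this] with t ht
    simp only [Pi.zero_apply] at ht
    simp [ht]
  · rw [← mul_assoc, ENNReal.mul_inv_cancel h0 hx.ne, one_mul]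

end Formulas

/-! ### Conditional laws in integrated form -/

section PairLaw

variable {Ω Ω' E : Type*} {mΩ : MeasurableSpace Ω} {mΩ' : MeasurableSpace Ω'} [MeasurableSpace E]

/-- If `κ` is the conditional law of `Z` given `Y`, expectations of functions of `(Y, Z)` are
computed by integrating out `Z` under `κ`. -/
theorem lintegral_pair_of_condLaw {P : Measure Ω} [IsFiniteMeasure P] {Y : Ω → Ω'} {Z : Ω → E}
    (hY : Measurable Y) (hZ : Measurable Z) (κ : Kernel Ω' E) [IsFiniteKernel κ]
    (h : ∀ C B, MeasurableSet C → MeasurableSet B →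
      P (Y ⁻¹' C ∩ Z ⁻¹' B) = ∫⁻ ω in Y ⁻¹' C, κ (Y ω) B ∂P)
    {ψ : Ω' → E → ℝ≥0∞} (hψ : Measurable (Function.uncurry ψ)) :
    ∫⁻ ω, ψ (Y ω) (Z ω) ∂P = ∫⁻ ω, ∫⁻ z, ψ (Y ω) z ∂κ (Y ω) ∂P := by
  have key : P.map (fun ω => (Y ω, Z ω)) = (P.map Y) ⊗ₘ κ := by
    refine Measure.ext_prod fun {C B} hC hB => ?_
    rw [Measure.map_apply (hY.prodMk hZ) (hC.prod hB), Measure.compProd_apply_prod hC hB,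
      setLIntegral_map hC (κ.measurable_coe hB) hY]
    exact h C B hC hB
  calc ∫⁻ ω, ψ (Y ω) (Z ω) ∂P
      = ∫⁻ p, Function.uncurry ψ p ∂(P.map fun ω => (Y ω, Z ω)) := by
        rw [lintegral_map hψ (hY.prodMk hZ)]; rfl
    _ = ∫⁻ y, ∫⁻ z, ψ y z ∂κ y ∂(P.map Y) := by
        rw [key, Measure.lintegral_compProd hψ]; rfl
    _ = _ := lintegral_map hψ.lintegral_kernel_prod_right hY

end PairLaw

/-- Translates a real-valued conditional probability into an identity of `ℝ≥0∞`-valued integrals;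
the bound `K ω univ ≤ 1` makes the passage lossless. -/
theorem measure_inter_of_condProb {Ω E : Type*} {m mΩ : MeasurableSpace Ω} [MeasurableSpace E]
    {P : Measure Ω} [IsFiniteMeasure P] (hm : m ≤ mΩ) {K : Ω → Measure E} (hK : Measurable K) (hK1 : ∀ ω, K ω Set.univ ≤ 1)
    {E' : Set Ω} (hE' : MeasurableSet E') {B : Set E} (hB : MeasurableSet B)
    (h : P⟦E' | m⟧ =ᵐ[P] fun ω => (K ω).real B) {C : Set Ω} (hC : MeasurableSet[m] C) :
    P (C ∩ E') = ∫⁻ ω in C, K ω B ∂P := by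
  have hle : ∀ ω, K ω B ≤ 1 := fun ω => (measure_mono (Set.subset_univ _)).trans (hK1 ω)
  have hKB : Measurable fun ω => K ω B := (Measure.measurable_coe hB).comp hK
  have h1 : ∫ ω in C, (K ω).real B ∂P = P.real (C ∩ E') := by
    rw [← setIntegral_congr_ae (hm _ hC) (h.mono fun ω hω _ => hω),
      setIntegral_condExp hm ((integrable_const (1 : ℝ)).indicator hE') hC,
      setIntegral_indicator hE']
    simp
  have h2 : ∫ ω in C, (K ω).real B ∂P = (∫⁻ ω in C, K ω B ∂P).toReal :=
    integral_toReal hKB.aemeasurable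
      (Eventually.of_forall fun ω => (hle ω).trans_lt ENNReal.one_lt_top)
  have hfin : ∫⁻ ω in C, K ω B ∂P ≠ ∞ := by
    refine ((lintegral_mono hle).trans_lt ?_).ne
    simp
  rw [← ENNReal.toReal_eq_toReal_iff' (measure_ne_top _ _) hfin, ← h2, h1]
  rfl

/-! ### Total mass and adaptedness of Newton's recursion -/

section Recursion

variable {Ω 𝕏 Θ : Type*} [mΩ : MeasurableSpace Ω] [MeasurableSpace 𝕏] [MeasurableSpace Θ]
  {f : 𝕏 → Θ → ℝ≥0} {α : ℕ → ℝ} {G₀ : Measure Θ} {X : ℕ → Ω → 𝕏}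

theorem ofReal_one_sub_add_ofReal {a : ℝ} (ha : a ∈ Set.Ioo (0 : ℝ) 1) :
    ENNReal.ofReal (1 - a) + ENNReal.ofReal a = 1 := by
  rw [← ENNReal.ofReal_add (by linarith [ha.2]) ha.1.le]
  simp

theorem past_mono (X : ℕ → Ω → 𝕏) {m n : ℕ} (h : m ≤ n) : past X m ≤ past X n :=
  biSup_mono fun _ hk => Finset.Icc_subset_Icc_right h hk

theorem past_le (hX : ∀ n, 1 ≤ n → Measurable (X n)) (n : ℕ) : past X n ≤ mΩ :=
  iSup₂_le fun k hk => (hX k (Finset.mem_Icc.1 hk).1).comap_le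

theorem measurable_past (X : ℕ → Ω → 𝕏) {k n : ℕ} (hk : 1 ≤ k) (hkn : k ≤ n) :
    Measurable[past X n] (X k) :=
  (comap_measurable (X k)).mono
    (le_iSup₂ (f := fun k (_ : k ∈ Finset.Icc 1 n) =>
      MeasurableSpace.comap (X k) inferInstance) k (Finset.mem_Icc.2 ⟨hk, hkn⟩)) le_rfl

theorem newton_univ_le_one (hα : ∀ n, 1 ≤ n → α n ∈ Set.Ioo (0 : ℝ) 1)
    (hG₀ : G₀ Set.univ ≤ 1) (x : ℕ → 𝕏) (n : ℕ) : newton f α G₀ x n Set.univ ≤ 1 := by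
  induction n with
  | zero => exact hG₀
  | succ n ih =>
    simp only [newton, Measure.add_apply, Measure.smul_apply, smul_eq_mul]
    calc _ ≤ ENNReal.ofReal (1 - α (n + 1)) * 1 + ENNReal.ofReal (α (n + 1)) * 1 := by
          gcongr
          exact posterior_univ_le_one _ _ _
      _ = 1 := by
          rw [mul_one, mul_one, ofReal_one_sub_add_ofReal (hα (n + 1) (by omega))]

theorem newtonAt_succ (n : ℕ) (ω : Ω) :
    newtonAt f α G₀ X (n + 1) ω = ENNReal.ofReal (1 - α (n + 1)) • newtonAt f α G₀ X n ω
      + ENNReal.ofReal (α (n + 1)) • posterior f (newtonAt f α G₀ X n ω) (X (n + 1) ω) := rfl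

theorem lintegral_newtonAt_succ (n : ℕ) (ω : Ω) (g : Θ → ℝ≥0∞) :
    ∫⁻ t, g t ∂newtonAt f α G₀ X (n + 1) ω
      = ENNReal.ofReal (1 - α (n + 1)) * ∫⁻ t, g t ∂newtonAt f α G₀ X n ω
        + ENNReal.ofReal (α (n + 1))
          * ∫⁻ t, g t ∂posterior f (newtonAt f α G₀ X n ω) (X (n + 1) ω) := by
  rw [newtonAt_succ, lintegral_add_measure, lintegral_smul_measure, lintegral_smul_measure]
  rfl

theorem measurable_newtonAt (hf : Measurable (Function.uncurry f))
    (hα : ∀ n, 1 ≤ n → α n ∈ Set.Ioo (0 : ℝ) 1) (hG₀ : G₀ Set.univ ≤ 1) (n : ℕ) :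
    Measurable[past X n] (newtonAt f α G₀ X n) := by
  induction n with
  | zero => exact measurable_const
  | succ n ih =>
    have h1 : Measurable[past X (n + 1)] (newtonAt f α G₀ X n) :=
      ih.mono (past_mono X n.le_succ) le_rfl
    have h2 : Measurable[past X (n + 1)]
        fun ω => posterior f (newtonAt f α G₀ X n ω) (X (n + 1) ω) :=
      measurable_posterior hf h1 (fun ω => newton_univ_le_one hα hG₀ _ n)
        (measurable_past X (by omega) le_rfl)
    refine Measure.measurable_of_measurable_coe _ fun A hA => ?_
    simp only [newtonAt_succ, Measure.add_apply, Measure.smul_apply, smul_eq_mul]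
    exact (((Measure.measurable_coe hA).comp h1).const_mul _).add
      (((Measure.measurable_coe hA).comp h2).const_mul _)

end Recursion

/-! ### The martingale property under the model -/

section Martingale

variable {Ω 𝕏 Θ : Type*} [mΩ : MeasurableSpace Ω] [MeasurableSpace 𝕏] [MeasurableSpace Θ]
  {P : Measure Ω} [IsProbabilityMeasure P] {μ : Measure 𝕏} [SigmaFinite μ]
  {f : 𝕏 → Θ → ℝ≥0} {α : ℕ → ℝ} {G₀ : Measure Θ} [IsProbabilityMeasure G₀]
  {X : ℕ → Ω → 𝕏} {θ : ℕ → Ω → Θ}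

theorem setLIntegral_comp_of_predictive (hf : Measurable (Function.uncurry f))
    (hα : ∀ n, 1 ≤ n → α n ∈ Set.Ioo (0 : ℝ) 1) (hmodel : IsNewtonModel P μ f α G₀ X θ)
    (n : ℕ) {C : Set Ω} (hC : MeasurableSet[past X n] C) {k : Θ → ℝ≥0∞} (hk : Measurable k) :
    ∫⁻ ω in C, k (θ (n + 1) ω) ∂P
      = ∫⁻ ω in C, ∫⁻ t, k t ∂newtonAt f α G₀ X n ω ∂P := by
  have hle := past_le hmodel.measurable_X n
  have hθ := hmodel.measurable_θ (n + 1) (by omega)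
  have hG : Measurable (newtonAt f α G₀ X n) :=
    (measurable_newtonAt hf hα prob_le_one n).mono hle le_rfl
  have key : (P.restrict C).map (θ (n + 1)) = (P.restrict C).bind (newtonAt f α G₀ X n) := by
    ext A hA
    rw [Measure.map_apply hθ hA, Measure.bind_apply hA hG.aemeasurable,
      Measure.restrict_apply (hθ hA), Set.inter_comm]
    exact measure_inter_of_condProb hle hG
      (fun ω => newton_univ_le_one hα prob_le_one _ n) (hθ hA) hA
      (hmodel.predictive n A hA) hC
  rw [← lintegral_map hk hθ, key, Measure.lintegral_bind hG.aemeasurable hk.aemeasurable]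

theorem measurable_withDensity_section (hf : Measurable (Function.uncurry f)) :
    Measurable fun t => μ.withDensity fun x => (f x t : ℝ≥0∞) := by
  refine Measure.measurable_of_measurable_coe _ fun B hB => ?_
  simp_rw [withDensity_apply _ hB]
  exact hf.coe_nnreal_ennreal.lintegral_prod_left'

theorem lintegral_withDensity_section (hf : Measurable (Function.uncurry f)) (H : Measure Θ)
    [SFinite H] {B : Set 𝕏} (hB : MeasurableSet B) :
    ∫⁻ t, μ.withDensity (fun x => (f x t : ℝ≥0∞)) B ∂H = mixture μ f H B := by
  simp_rw [mixture, withDensity_apply _ hB, mixDensity]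
  exact (lintegral_lintegral_swap hf.coe_nnreal_ennreal.aemeasurable).symm

/-- The conditional law of `X_{n+1}` given `X_1, …, X_n` is the mixture `F_{G_n}`. -/
theorem measure_inter_preimage_observation (hf : Measurable (Function.uncurry f))
    (hf1 : ∀ t, ∫⁻ x, (f x t : ℝ≥0∞) ∂μ = 1)
    (hα : ∀ n, 1 ≤ n → α n ∈ Set.Ioo (0 : ℝ) 1) (hmodel : IsNewtonModel P μ f α G₀ X θ)
    (n : ℕ) {C : Set Ω} (hC : MeasurableSet[past X n] C) {B : Set 𝕏} (hB : MeasurableSet B) :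
    P (C ∩ X (n + 1) ⁻¹' B) = ∫⁻ ω in C, mixture μ f (newtonAt f α G₀ X n ω) B ∂P := by
  have hθ := hmodel.measurable_θ (n + 1) (by omega)
  have hK := measurable_withDensity_section (μ := μ) hf
  have hle : past X n ⊔ MeasurableSpace.comap (θ (n + 1)) inferInstance ≤ mΩ :=
    sup_le (past_le hmodel.measurable_X n) hθ.comap_le
  have hK1 : ∀ t, μ.withDensity (fun x => (f x t : ℝ≥0∞)) Set.univ ≤ 1 := fun t => by
    rw [withDensity_apply _ MeasurableSet.univ, setLIntegral_univ, hf1]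
  -- `C` also lies in the larger sigma-field generated by the past and `θ_{n+1}`, so the sampling
  -- law applies on it; `θ_{n+1}` is then integrated out by the predictive law.
  rw [measure_inter_of_condProb hle (hK.comp hθ) (fun ω => hK1 _)
    (hmodel.measurable_X (n + 1) (by omega) hB) hB (hmodel.sampling n B hB)
    ((le_sup_left : past X n ≤ _) _ hC)]
  refine (setLIntegral_comp_of_predictive hf hα hmodel n hC
    ((Measure.measurable_coe hB).comp hK)).trans ?_
  refine lintegral_congr fun ω => ?_
  have : IsFiniteMeasure (newtonAt f α G₀ X n ω) :=
    ⟨(newton_univ_le_one hα prob_le_one _ n).trans_lt ENNReal.one_lt_top⟩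
  exact lintegral_withDensity_section hf _ hB

theorem measurable_mixture {S : Type*} {mS : MeasurableSpace S}
    (hf : Measurable (Function.uncurry f)) {κ : S → Measure Θ} (hκ : Measurable κ)
    (hκ1 : ∀ s, κ s Set.univ ≤ 1) : Measurable fun s => mixture μ f (κ s) := by
  refine Measure.measurable_of_measurable_coe _ fun B hB => ?_
  simp_rw [mixture, withDensity_apply _ hB]
  exact Measurable.lintegral_prod_right' (f := fun p : S × 𝕏 => mixDensity f (κ p.1) p.2)
    (measurable_mixDensity hf (hκ.comp measurable_fst) (fun p => hκ1 p.1) measurable_snd)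

/-- The martingale property of `∫ g dG_n`, in integrated form and for all nonnegative `g`. -/
theorem setLIntegral_lintegral_newtonAt_succ (hf : Measurable (Function.uncurry f))
    (hf1 : ∀ t, ∫⁻ x, (f x t : ℝ≥0∞) ∂μ = 1)
    (hα : ∀ n, 1 ≤ n → α n ∈ Set.Ioo (0 : ℝ) 1) (hmodel : IsNewtonModel P μ f α G₀ X θ)
    (n : ℕ) {C : Set Ω} (hC : MeasurableSet[past X n] C) {g : Θ → ℝ≥0∞} (hg : Measurable g) :
    ∫⁻ ω in C, ∫⁻ t, g t ∂newtonAt f α G₀ X (n + 1) ω ∂P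
      = ∫⁻ ω in C, ∫⁻ t, g t ∂newtonAt f α G₀ X n ω ∂P := by
  have hle := past_le hmodel.measurable_X n
  have hXm := hmodel.measurable_X (n + 1) (by omega)
  have hG := measurable_newtonAt (X := X) hf hα (G₀ := G₀) prob_le_one n
  have hG1 : ∀ ω, newtonAt f α G₀ X n ω Set.univ ≤ 1 :=
    fun ω => newton_univ_le_one hα prob_le_one _ n
  have hGΩ : Measurable (newtonAt f α G₀ X n) := hG.mono hle le_rfl
  have hfin : ∀ ω, IsFiniteMeasure (newtonAt f α G₀ X n ω) :=
    fun ω => ⟨(hG1 ω).trans_lt ENNReal.one_lt_top⟩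
  let κ : @Kernel Ω 𝕏 (past X n) _ :=
    @Kernel.mk Ω 𝕏 (past X n) _ (fun ω => mixture μ f (newtonAt f α G₀ X n ω))
      (measurable_mixture hf hG hG1)
  have hκ : @IsFiniteKernel Ω 𝕏 (past X n) _ κ := by
    refine @IsFiniteKernel.mk Ω 𝕏 (past X n) _ κ ⟨1, ENNReal.one_lt_top, fun ω => ?_⟩
    change mixture μ f (newtonAt f α G₀ X n ω) Set.univ ≤ 1
    rw [mixture, withDensity_apply _ MeasurableSet.univ, setLIntegral_univ,
      lintegral_mixDensity hf hf1]
    exact hG1 ω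
  have hψ : Measurable[(past X n).prod inferInstance] (Function.uncurry fun (ω : Ω) (x : 𝕏) =>
      ∫⁻ t, g t ∂posterior f (newtonAt f α G₀ X n ω) x) := by
    refine (Measure.measurable_lintegral hg).comp ?_
    exact @measurable_posterior (Ω × 𝕏) 𝕏 Θ ((past X n).prod inferInstance) _ _ f hf
      (fun p => newtonAt f α G₀ X n p.1)
      (hG.comp (@measurable_fst Ω 𝕏 (past X n) _)) (fun p => hG1 p.1) (fun p => p.2)
      (@measurable_snd Ω 𝕏 (past X n) _)
  have key : ∫⁻ ω in C, ∫⁻ t, g t ∂posterior f (newtonAt f α G₀ X n ω) (X (n + 1) ω) ∂P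
      = ∫⁻ ω in C, ∫⁻ t, g t ∂newtonAt f α G₀ X n ω ∂P := by
    -- The conditioning variable is the identity into `Ω` equipped with the sigma-field of the past,
    -- so the integrand may depend on `G_n` itself.
    refine (@lintegral_pair_of_condLaw Ω Ω 𝕏 mΩ (past X n) _ (P.restrict C) _ id (X (n + 1))
      (measurable_id'' hle) hXm κ hκ ?_ _ hψ).trans ?_
    · intro D B hD hB
      have hDC : MeasurableSet[past X n] (D ∩ C) := hD.inter hC
      rw [Set.preimage_id, Measure.restrict_restrict (hle _ hD),
        Measure.restrict_apply ((hle _ hD).inter (hXm hB)), Set.inter_right_comm]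
      exact measure_inter_preimage_observation hf hf1 hα hmodel n hDC hB
    · exact lintegral_congr fun ω => lintegral_lintegral_posterior hf hf1 _ hg
  have hGm : Measurable fun ω => ∫⁻ t, g t ∂newtonAt f α G₀ X n ω :=
    (Measure.measurable_lintegral hg).comp hGΩ
  have hpm : Measurable fun ω => ∫⁻ t, g t ∂posterior f (newtonAt f α G₀ X n ω) (X (n + 1) ω) :=
    (Measure.measurable_lintegral hg).comp (measurable_posterior hf hGΩ hG1 hXm)
  simp_rw [lintegral_newtonAt_succ]
  rw [lintegral_add_left (hGm.const_mul _), lintegral_const_mul _ hGm, lintegral_const_mul _ hpm,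
    key, ← add_mul, ofReal_one_sub_add_ofReal (hα (n + 1) (by omega)), one_mul]

end Martingale

/-! ### Measure-valued martingales and almost sure limits of their integrals -/

/-- A measure-valued martingale of mass at most one, started at a deterministic measure. -/
structure IsMeasureMartingale {Ω Θ : Type*} {mΩ : MeasurableSpace Ω} [MeasurableSpace Θ]
    (P : Measure Ω) (ℱ : Filtration ℕ mΩ) (G₀ : Measure Θ) (G : ℕ → Ω → Measure Θ) : Prop where
  zero : ∀ ω, G 0 ω = G₀
  measurable_past : ∀ n, Measurable[ℱ n] (G n)
  univ_le_one : ∀ n ω, G n ω Set.univ ≤ 1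
  setLIntegral_succ : ∀ (n : ℕ) (C : Set Ω), MeasurableSet[ℱ n] C → ∀ g : Θ → ℝ≥0∞, Measurable g →
    ∫⁻ ω in C, ∫⁻ t, g t ∂G (n + 1) ω ∂P = ∫⁻ ω in C, ∫⁻ t, g t ∂G n ω ∂P

section Convergence

variable {Ω Θ : Type*} {mΩ : MeasurableSpace Ω} [MeasurableSpace Θ] {P : Measure Ω}

/-- A sequence converges to any lower bound of its lower limit that has the same integral. -/
theorem ae_tendsto_of_le_liminf {u : ℕ → Ω → ℝ≥0∞} (hu : ∀ n, Measurable (u n))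
    (hlim : ∀ᵐ ω ∂P, ∃ c, Tendsto (fun n => u n ω) atTop (𝓝 c)) {a : ℝ≥0∞} (ha : a ≠ ∞)
    (hua : ∀ n, ∫⁻ ω, u n ω ∂P ≤ a) {W : Ω → ℝ≥0∞}
    (hW : ∀ᵐ ω ∂P, W ω ≤ liminf (fun n => u n ω) atTop) (hWa : ∫⁻ ω, W ω ∂P = a) :
    ∀ᵐ ω ∂P, Tendsto (fun n => u n ω) atTop (𝓝 (W ω)) := by
  have hle : ∫⁻ ω, liminf (fun n => u n ω) atTop ∂P ≤ ∫⁻ ω, W ω ∂P := by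
    refine (lintegral_liminf_le hu).trans ?_
    rw [hWa]
    exact liminf_le_of_le (by isBoundedDefault) fun b hb =>
      (hb.exists.choose_spec).trans (hua _)
  have hlm : Measurable fun ω => liminf (fun n => u n ω) atTop := .liminf hu
  filter_upwards [hlim, ae_eq_of_ae_le_of_lintegral_le hW (hWa ▸ ha) hlm.aemeasurable hle]
    with ω ⟨c, hc⟩ h
  rw [h, hc.liminf_eq]
  exact hc

namespace IsMeasureMartingale

variable [IsProbabilityMeasure P] {ℱ : Filtration ℕ mΩ} {G₀ : Measure Θ} {G : ℕ → Ω → Measure Θ}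

theorem measurable (hG : IsMeasureMartingale P ℱ G₀ G) (n : ℕ) : Measurable (G n) :=
  (hG.measurable_past n).mono (ℱ.le n) le_rfl

theorem apply_le_one (hG : IsMeasureMartingale P ℱ G₀ G) (n : ℕ) (ω : Ω) (A : Set Θ) :
    G n ω A ≤ 1 :=
  (measure_mono (Set.subset_univ A)).trans (hG.univ_le_one n ω)

theorem measurable_apply (hG : IsMeasureMartingale P ℱ G₀ G) (n : ℕ) {A : Set Θ}
    (hA : MeasurableSet A) : Measurable fun ω => G n ω A :=
  (Measure.measurable_coe hA).comp (hG.measurable n)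

theorem measurable_lintegral (hG : IsMeasureMartingale P ℱ G₀ G) (n : ℕ) {g : Θ → ℝ≥0∞}
    (hg : Measurable g) : Measurable fun ω => ∫⁻ t, g t ∂G n ω :=
  (Measure.measurable_lintegral hg).comp (hG.measurable n)

theorem lintegral_lintegral (hG : IsMeasureMartingale P ℱ G₀ G) (n : ℕ) {g : Θ → ℝ≥0∞}
    (hg : Measurable g) : ∫⁻ ω, ∫⁻ t, g t ∂G n ω ∂P = ∫⁻ t, g t ∂G₀ := by
  induction n with
  | zero => simp [hG.zero]
  | succ n ih =>
    simpa [ih] using hG.setLIntegral_succ n Set.univ MeasurableSet.univ g hg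

theorem lintegral_apply (hG : IsMeasureMartingale P ℱ G₀ G) (n : ℕ) {A : Set Θ}
    (hA : MeasurableSet A) : ∫⁻ ω, G n ω A ∂P = G₀ A := by
  simpa [lintegral_indicator_one hA] using
    hG.lintegral_lintegral n (g := A.indicator 1) (measurable_one.indicator hA)

/-- A nonnegative martingale has constant mean, hence is bounded in `L¹` and converges. Unbounded
`g` is allowed because the result is later applied to `f(x ∣ ·)`. -/
theorem exists_ae_tendsto_lintegral (hG : IsMeasureMartingale P ℱ G₀ G) {g : Θ → ℝ≥0∞}
    (hg : Measurable g) (hg0 : ∫⁻ t, g t ∂G₀ ≠ ∞) :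
    ∀ᵐ ω ∂P, ∃ c, Tendsto (fun n => ∫⁻ t, g t ∂G n ω) atTop (𝓝 c) := by
  have hm : ∀ n, Measurable fun ω => ∫⁻ t, g t ∂G n ω := fun n => hG.measurable_lintegral n hg
  have hI : ∀ n, ∫⁻ ω, ∫⁻ t, g t ∂G n ω ∂P ≠ ∞ := fun n => by rwa [hG.lintegral_lintegral n hg]
  have hlt : ∀ n, ∀ᵐ ω ∂P, ∫⁻ t, g t ∂G n ω < ∞ := fun n => ae_lt_top (hm n) (hI n)
  have hint : ∀ n, Integrable (fun ω => (∫⁻ t, g t ∂G n ω).toReal) P :=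
    fun n => integrable_toReal_of_lintegral_ne_top (hm n).aemeasurable (hI n)
  have hmart : Martingale (fun n ω => (∫⁻ t, g t ∂G n ω).toReal) ℱ P := by
    refine martingale_of_setIntegral_eq_succ (fun n => ?_) hint fun n C hC => ?_
    · exact (Measurable.ennreal_toReal
        ((Measure.measurable_lintegral hg).comp (hG.measurable_past n))).stronglyMeasurable
    · rw [integral_toReal (hm n).aemeasurable (ae_restrict_of_ae (hlt n)),
        integral_toReal (hm (n + 1)).aemeasurable (ae_restrict_of_ae (hlt (n + 1))),
        hG.setLIntegral_succ n C hC g hg]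
  have hbdd : ∀ n, eLpNorm (fun ω => (∫⁻ t, g t ∂G n ω).toReal) 1 P
      ≤ ((∫⁻ t, g t ∂G₀).toNNReal : ℝ≥0∞) := fun n => by
    rw [eLpNorm_one_eq_lintegral_enorm, ENNReal.coe_toNNReal hg0, ← hG.lintegral_lintegral n hg]
    refine lintegral_mono fun ω => ?_
    rw [Real.enorm_eq_ofReal ENNReal.toReal_nonneg]
    exact ENNReal.ofReal_toReal_le
  filter_upwards [hmart.submartingale.exists_ae_tendsto_of_bdd hbdd, ae_all_iff.2 hlt]
    with ω ⟨c, hc⟩ hω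
  refine ⟨ENNReal.ofReal c, (ENNReal.tendsto_ofReal hc).congr fun n => ?_⟩
  exact ENNReal.ofReal_toReal (hω n).ne

theorem exists_ae_tendsto_apply [IsFiniteMeasure G₀] (hG : IsMeasureMartingale P ℱ G₀ G)
    {A : Set Θ} (hA : MeasurableSet A) :
    ∀ᵐ ω ∂P, ∃ c, Tendsto (fun n => G n ω A) atTop (𝓝 c) := by
  simpa [lintegral_indicator_one hA] using
    hG.exists_ae_tendsto_lintegral (g := A.indicator 1) (measurable_one.indicator hA)
      (by simp [lintegral_indicator_one hA])

/-- The mass is at most one everywhere and has mean one. It can drop only on a null event, such as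
when an observation has a zero posterior. -/
theorem ae_univ_eq_one [IsProbabilityMeasure G₀] (hG : IsMeasureMartingale P ℱ G₀ G) :
    ∀ᵐ ω ∂P, ∀ n, G n ω Set.univ = 1 := by
  refine ae_all_iff.2 fun n => ?_
  have h := hG.lintegral_apply n MeasurableSet.univ
  refine ae_eq_of_ae_le_of_lintegral_le (g := fun _ => 1)
    (Eventually.of_forall fun ω => hG.univ_le_one n ω) (by simp [h]) measurable_const.aemeasurable
    (by simp [h])

theorem lintegral_of_ae_tendsto (hG : IsMeasureMartingale P ℱ G₀ G) {A : Set Θ}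
    (hA : MeasurableSet A) {W : Ω → ℝ≥0∞}
    (h : ∀ᵐ ω ∂P, Tendsto (fun n => G n ω A) atTop (𝓝 (W ω))) : ∫⁻ ω, W ω ∂P = G₀ A := by
  have := tendsto_lintegral_of_dominated_convergence (fun _ => 1)
    (fun n => hG.measurable_apply n hA)
    (fun n => Eventually.of_forall fun ω => hG.apply_le_one n ω A) (by simp) h
  simp_rw [hG.lintegral_apply _ hA] at this
  exact tendsto_nhds_unique this tendsto_const_nhds

/-- Setwise almost sure convergence extends to integrals of `G₀`-integrable functions. -/
theorem ae_tendsto_lintegral (hG : IsMeasureMartingale P ℱ G₀ G)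
    {K : Kernel Ω Θ} [IsMarkovKernel K]
    (hK : ∀ A, MeasurableSet A → ∀ᵐ ω ∂P, Tendsto (fun n => G n ω A) atTop (𝓝 (K ω A)))
    {g : Θ → ℝ≥0∞} (hg : Measurable g) (hg0 : ∫⁻ t, g t ∂G₀ ≠ ∞) :
    ∀ᵐ ω ∂P, Tendsto (fun n => ∫⁻ t, g t ∂G n ω) atTop (𝓝 (∫⁻ t, g t ∂K ω)) := by
  have hbind : P.bind K = G₀ := by
    ext A hA
    rw [Measure.bind_apply hA K.measurable.aemeasurable]
    exact hG.lintegral_of_ae_tendsto hA (hK A hA)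
  refine ae_tendsto_of_le_liminf (fun n => hG.measurable_lintegral n hg)
    (hG.exists_ae_tendsto_lintegral hg hg0) hg0 (fun n => (hG.lintegral_lintegral n hg).le) ?_ ?_
  -- The approximating simple functions involve only countably many level sets, so one null set
  -- suffices; their integrals converge and bound the lower limit from below.
  · have hs : ∀ᵐ ω ∂P, ∀ k, ∀ r ∈ (SimpleFunc.eapprox g k).range,
        Tendsto (fun n => G n ω (SimpleFunc.eapprox g k ⁻¹' {r})) atTop
          (𝓝 (K ω (SimpleFunc.eapprox g k ⁻¹' {r}))) := by
      refine ae_all_iff.2 fun k => ?_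
      refine (ae_ball_iff (Finset.countable_toSet _)).2 fun r _ => ?_
      exact hK _ (SimpleFunc.measurableSet_preimage _ _)
    filter_upwards [hs] with ω hω
    rw [lintegral_eq_iSup_eapprox_lintegral hg]
    refine iSup_le fun k => ?_
    have ht : Tendsto (fun n => (SimpleFunc.eapprox g k).lintegral (G n ω)) atTop
        (𝓝 ((SimpleFunc.eapprox g k).lintegral (K ω))) := by
      refine tendsto_finsetSum _ fun r hr => ?_
      refine ENNReal.Tendsto.const_mul (hω k r hr) (Or.inr ?_)
      obtain ⟨t, rfl⟩ := SimpleFunc.mem_range.1 hr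
      exact (SimpleFunc.eapprox_lt_top g k t).ne
    rw [← ht.liminf_eq]
    refine liminf_le_liminf (Eventually.of_forall fun n => ?_)
    rw [lintegral_eq_iSup_eapprox_lintegral hg]
    exact le_iSup (fun k => (SimpleFunc.eapprox g k).lintegral (G n ω)) k
  · rw [← Measure.lintegral_bind K.measurable.aemeasurable hg.aemeasurable, hbind]

end IsMeasureMartingale

end Convergence

/-! ### Construction of the limit kernel, setwise and weak convergence -/

namespace IsMeasureMartingale

variable {Ω Θ : Type*} {mΩ : MeasurableSpace Ω} [MeasurableSpace Θ] {P : Measure Ω}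
  [IsProbabilityMeasure P] {ℱ : Filtration ℕ mΩ} {G₀ : Measure Θ} [IsProbabilityMeasure G₀]
  {G : ℕ → Ω → Measure Θ}

theorem ae_tendsto_limsup (hG : IsMeasureMartingale P ℱ G₀ G) {A : Set Θ} (hA : MeasurableSet A) :
    ∀ᵐ ω ∂P, Tendsto (fun n => G n ω A) atTop (𝓝 (limsup (fun n => G n ω A) atTop)) := by
  filter_upwards [hG.exists_ae_tendsto_apply hA] with ω ⟨c, hc⟩
  rwa [hc.limsup_eq]

theorem lintegral_limsup (hG : IsMeasureMartingale P ℱ G₀ G) {A : Set Θ} (hA : MeasurableSet A) :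
    ∫⁻ ω, limsup (fun n => G n ω A) atTop ∂P = G₀ A :=
  hG.lintegral_of_ae_tendsto hA (hG.ae_tendsto_limsup hA)

theorem measurable_limsup (hG : IsMeasureMartingale P ℱ G₀ G) {A : Set Θ} (hA : MeasurableSet A) :
    Measurable fun ω => limsup (fun n => G n ω A) atTop :=
  .limsup fun n => hG.measurable_apply n hA

theorem limsup_le_one (hG : IsMeasureMartingale P ℱ G₀ G) (ω : Ω) (A : Set Θ) :
    limsup (fun n => G n ω A) atTop ≤ 1 :=
  limsup_le_of_le (by isBoundedDefault) (Eventually.of_forall fun n => hG.apply_le_one n ω A)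

theorem limsup_mono (G : ℕ → Ω → Measure Θ) (ω : Ω) {A B : Set Θ} (h : A ⊆ B) :
    limsup (fun n => G n ω A) atTop ≤ limsup (fun n => G n ω B) atTop :=
  limsup_le_limsup (Eventually.of_forall fun _ => measure_mono h)

/-- One inequality is monotonicity. Both sides have integral `G₀ (⋂ k, A k)`, so they agree almost
everywhere. -/
theorem ae_iInf_limsup (hG : IsMeasureMartingale P ℱ G₀ G) {A : ℕ → Set Θ}
    (hA : ∀ k, MeasurableSet (A k)) (hanti : Antitone A) :
    ∀ᵐ ω ∂P, ⨅ k, limsup (fun n => G n ω (A k)) atTop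
      = limsup (fun n => G n ω (⋂ k, A k)) atTop := by
  have h1 : ∫⁻ ω, ⨅ k, limsup (fun n => G n ω (A k)) atTop ∂P = G₀ (⋂ k, A k) := by
    rw [lintegral_iInf (fun k => hG.measurable_limsup (hA k))
      (fun i j hij ω => limsup_mono G ω (hanti hij))
      (by rw [hG.lintegral_limsup (hA 0)]; exact measure_ne_top _ _),
      hanti.measure_iInter (fun k => (hA k).nullMeasurableSet) ⟨0, measure_ne_top _ _⟩]
    exact iInf_congr fun k => hG.lintegral_limsup (hA k)
  have h2 := hG.lintegral_limsup (MeasurableSet.iInter hA)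
  have h3 := ae_eq_of_ae_le_of_lintegral_le (μ := P)
    (f := fun ω => limsup (fun n => G n ω (⋂ k, A k)) atTop)
    (g := fun ω => ⨅ k, limsup (fun n => G n ω (A k)) atTop)
    (Eventually.of_forall fun ω => le_iInf fun k => limsup_mono G ω (Set.iInter_subset A k))
    (by rw [h2]; exact measure_ne_top _ _)
    (Measurable.iInf fun k => hG.measurable_limsup (hA k)).aemeasurable (by rw [h1, h2])
  filter_upwards [h3] with ω h using h.symm

theorem ae_iSup_limsup (hG : IsMeasureMartingale P ℱ G₀ G) {A : ℕ → Set Θ}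
    (hA : ∀ k, MeasurableSet (A k)) (hmono : Monotone A) :
    ∀ᵐ ω ∂P, ⨆ k, limsup (fun n => G n ω (A k)) atTop
      = limsup (fun n => G n ω (⋃ k, A k)) atTop := by
  have h1 : ∫⁻ ω, ⨆ k, limsup (fun n => G n ω (A k)) atTop ∂P = G₀ (⋃ k, A k) := by
    rw [lintegral_iSup (fun k => hG.measurable_limsup (hA k))
      (fun i j hij ω => limsup_mono G ω (hmono hij)), hmono.measure_iUnion]
    exact iSup_congr fun k => hG.lintegral_limsup (hA k)
  have h2 := hG.lintegral_limsup (MeasurableSet.iUnion hA)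
  exact ae_eq_of_ae_le_of_lintegral_le (μ := P)
    (Eventually.of_forall fun ω => iSup_le fun k => limsup_mono G ω (Set.subset_iUnion A k))
    (by rw [h1]; exact measure_ne_top _ _)
    (hG.measurable_limsup (MeasurableSet.iUnion hA)).aemeasurable (by rw [h1, h2])

/-- The almost sure limit of the distribution functions of the images of `G n` under `e`, at
rational points. -/
noncomputable def limitRatCDF (e : Θ → ℝ) (G : ℕ → Ω → Measure Θ) (ω : Ω) (q : ℚ) : ℝ :=
  (limsup (fun n => G n ω (e ⁻¹' Set.Iic (q : ℝ))) atTop).toReal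

theorem measurable_limitRatCDF (hG : IsMeasureMartingale P ℱ G₀ G) {e : Θ → ℝ}
    (he : Measurable e) : Measurable (limitRatCDF e G) :=
  measurable_pi_lambda _ fun _ => (hG.measurable_limsup (he measurableSet_Iic)).ennreal_toReal

theorem monotone_limitRatCDF (hG : IsMeasureMartingale P ℱ G₀ G) (e : Θ → ℝ) (ω : Ω) :
    Monotone (limitRatCDF e G ω) := fun q r hqr =>
  ENNReal.toReal_mono ((hG.limsup_le_one ω _).trans_lt ENNReal.one_lt_top).ne
    (limsup_mono G ω (Set.preimage_mono (Set.Iic_subset_Iic.2 (by exact_mod_cast hqr))))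

/-- The limits at `±∞` and right continuity at each rational reduce to monotone sequences of
half-lines (endpoints `-k`, `k` and `q + 1/(k+1)`), to which `ae_iInf_limsup` and `ae_iSup_limsup`
apply; countably many null sets are discarded. -/
theorem ae_isRatStieltjesPoint (hG : IsMeasureMartingale P ℱ G₀ G) {e : Θ → ℝ}
    (he : Measurable e) : ∀ᵐ ω ∂P, IsRatStieltjesPoint (limitRatCDF e G) ω := by
  have hI : ∀ r : ℝ, MeasurableSet (e ⁻¹' Set.Iic r) := fun r => he measurableSet_Iic
  have hfin : ∀ ω A, limsup (fun n => G n ω A) atTop ≠ ∞ :=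
    fun ω A => ((hG.limsup_le_one ω A).trans_lt ENNReal.one_lt_top).ne
  have hbot := hG.ae_iInf_limsup (A := fun k : ℕ => e ⁻¹' Set.Iic (((-k : ℤ) : ℚ) : ℝ))
    (fun k => hI _) (fun i j hij => Set.preimage_mono (Set.Iic_subset_Iic.2 (by
      push_cast; exact neg_le_neg (by exact_mod_cast hij))))
  have htop := hG.ae_iSup_limsup (A := fun k : ℕ => e ⁻¹' Set.Iic (((k : ℕ) : ℚ) : ℝ))
    (fun k => hI _) (fun i j hij => Set.preimage_mono (Set.Iic_subset_Iic.2 (by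
      push_cast; exact_mod_cast hij)))
  have hright := ae_all_iff.2 fun q : ℚ =>
    hG.ae_iInf_limsup (A := fun k : ℕ => e ⁻¹' Set.Iic ((q + 1 / ((k : ℚ) + 1) : ℚ) : ℝ))
      (fun k => hI _) (fun i j hij => Set.preimage_mono (Set.Iic_subset_Iic.2 (by
        have : (1 : ℚ) / ((j : ℚ) + 1) ≤ 1 / ((i : ℚ) + 1) := by gcongr
        exact_mod_cast add_le_add_right this q)))
  have htoT : ∀ (u : ℕ → ℝ≥0∞), (∀ k, u k ≤ 1) → (⨅ k, u k).toReal = ⨅ k, (u k).toReal :=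
    fun u hu => ENNReal.toReal_iInf fun k => ((hu k).trans_lt ENNReal.one_lt_top).ne
  have htoS : ∀ (u : ℕ → ℝ≥0∞), (∀ k, u k ≤ 1) → (⨆ k, u k).toReal = ⨆ k, (u k).toReal :=
    fun u hu => ENNReal.toReal_iSup fun k => ((hu k).trans_lt ENNReal.one_lt_top).ne
  have hU : (⋃ k : ℕ, e ⁻¹' Set.Iic (((k : ℕ) : ℚ) : ℝ)) = Set.univ := by
    refine Set.eq_univ_of_forall fun t => Set.mem_iUnion.2 ?_
    obtain ⟨k, hk⟩ := exists_nat_ge (e t)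
    exact ⟨k, by simpa using hk⟩
  have hE : (⋂ k : ℕ, e ⁻¹' Set.Iic (((-k : ℤ) : ℚ) : ℝ)) = ∅ := by
    refine Set.eq_empty_of_forall_notMem fun t ht => ?_
    obtain ⟨k, hk⟩ := exists_nat_gt (-(e t))
    have := Set.mem_iInter.1 ht k
    simp only [Set.mem_preimage, Set.mem_Iic] at this
    push_cast at this
    linarith
  have hR : ∀ q : ℚ, (⋂ k : ℕ, e ⁻¹' Set.Iic ((q + 1 / ((k : ℚ) + 1) : ℚ) : ℝ))
      = e ⁻¹' Set.Iic (q : ℝ) := by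
    intro q
    ext t
    simp only [Set.mem_iInter, Set.mem_preimage, Set.mem_Iic]
    constructor
    · intro h
      refine le_of_forall_pos_le_add fun ε hε => ?_
      obtain ⟨k, hk⟩ := exists_nat_one_div_lt hε
      have := h k
      push_cast at this
      linarith
    · intro h k
      have : (0 : ℝ) ≤ 1 / ((k : ℝ) + 1) := by positivity
      push_cast
      linarith
  filter_upwards [hbot, htop, hright, hG.ae_univ_eq_one] with ω h1 h2 h3 h4
  have hmono := hG.monotone_limitRatCDF e ω
  rw [hE] at h1
  rw [hU] at h2
  simp only [measure_empty, limsup_const, h4] at h1 h2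
  refine ⟨hmono, ?_, ?_, fun q => ?_⟩
  · refine tendsto_atTop_isLUB hmono ?_
    have hs : ⨆ k : ℕ, limitRatCDF e G ω (k : ℚ) = 1 := by
      rw [← ENNReal.toReal_one, ← h2, htoS _ fun k => hG.limsup_le_one ω _]
      rfl
    have hle : ∀ q, limitRatCDF e G ω q ≤ 1 := fun q =>
      ENNReal.toReal_le_of_le_ofReal zero_le_one (by simpa using hG.limsup_le_one ω _)
    refine ⟨Set.forall_mem_range.2 hle, fun b hb => ?_⟩
    rw [← hs]
    exact ciSup_le fun k => hb ⟨_, rfl⟩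
  · refine tendsto_atBot_isGLB hmono ?_
    have hs : ⨅ k : ℕ, limitRatCDF e G ω ((-k : ℤ) : ℚ) = 0 := by
      rw [← ENNReal.toReal_zero, ← h1, htoT _ fun k => hG.limsup_le_one ω _]
      rfl
    refine ⟨Set.forall_mem_range.2 fun q => ENNReal.toReal_nonneg, fun b hb => ?_⟩
    rw [← hs]
    exact le_ciInf fun k => hb ⟨_, rfl⟩
  · have h3q := h3 q
    rw [hR] at h3q
    have hs : ⨅ k : ℕ, limitRatCDF e G ω (q + 1 / ((k : ℚ) + 1)) = limitRatCDF e G ω q := by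
      rw [limitRatCDF, ← h3q, htoT _ fun k => hG.limsup_le_one ω _]
      rfl
    have hbdd : BddBelow (Set.range fun r : Set.Ioi q => limitRatCDF e G ω r) :=
      ⟨0, Set.forall_mem_range.2 fun r => ENNReal.toReal_nonneg⟩
    refine le_antisymm ?_ (le_ciInf fun r => hmono r.2.le)
    rw [← hs]
    refine le_ciInf fun k => ?_
    exact ciInf_le hbdd ⟨q + 1 / ((k : ℚ) + 1), by
      have : (0 : ℚ) < 1 / ((k : ℚ) + 1) := by positivity
      simpa using this⟩

/-- Almost sure convergence on the rational half-lines gives setwise almost sure convergence. -/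
theorem ae_tendsto_of_tendsto_Iic (hG : IsMeasureMartingale P ℱ G₀ G) {e : Θ → ℝ}
    (he : Measurable e) {K : Kernel Ω ℝ} [IsMarkovKernel K]
    (hK : ∀ q : ℚ, ∀ᵐ ω ∂P,
      Tendsto (fun n => G n ω (e ⁻¹' Set.Iic (q : ℝ))) atTop (𝓝 (K ω (Set.Iic (q : ℝ)))))
    {B : Set ℝ} (hB : MeasurableSet B) :
    ∀ᵐ ω ∂P, Tendsto (fun n => G n ω (e ⁻¹' B)) atTop (𝓝 (K ω B)) := by
  induction B, hB using MeasurableSpace.induction_on_inter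
    Real.borel_eq_generateFrom_Iic_rat Real.isPiSystem_Iic_rat with
  | empty => simp
  | basic B hB =>
    obtain ⟨q, rfl⟩ := Set.mem_iUnion.1 hB
    exact hK q
  | compl B hB ih =>
    filter_upwards [ih, hG.ae_univ_eq_one] with ω h h1
    have h2 : ∀ n, G n ω (e ⁻¹' Bᶜ) = 1 - G n ω (e ⁻¹' B) := fun n => by
      have : IsProbabilityMeasure (G n ω) := ⟨h1 n⟩
      rw [Set.preimage_compl, prob_compl_eq_one_sub (he hB)]
    simp_rw [h2]
    rw [prob_compl_eq_one_sub hB]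
    exact ENNReal.Tendsto.sub tendsto_const_nhds h (Or.inl ENNReal.one_ne_top)
  | iUnion B hdisj hB ih =>
    have hU : MeasurableSet (e ⁻¹' ⋃ i, B i) := he (MeasurableSet.iUnion hB)
    -- Finite partial unions give only a lower bound for the lower limit; equality follows because
    -- `K ω (⋃ i, B i)` has mean `G₀ (e ⁻¹' ⋃ i, B i)`.
    refine ae_tendsto_of_le_liminf (fun n => hG.measurable_apply n hU)
      (hG.exists_ae_tendsto_apply hU) (measure_ne_top G₀ (e ⁻¹' ⋃ i, B i))
      (fun n => (hG.lintegral_apply n hU).le) ?_ ?_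
    · filter_upwards [ae_all_iff.2 ih] with ω h
      rw [measure_iUnion hdisj hB, ENNReal.tsum_eq_iSup_sum]
      refine iSup_le fun s => ?_
      rw [← (tendsto_finsetSum s fun i _ => h i).liminf_eq]
      refine liminf_le_liminf (Eventually.of_forall fun n => ?_)
      rw [← measure_biUnion_finset
        (fun i _ j _ hij => (hdisj hij).preimage e) (fun i _ => he (hB i))]
      exact measure_mono (Set.iUnion₂_subset fun i _ =>
        Set.preimage_mono (Set.subset_iUnion B i))
    · simp_rw [measure_iUnion hdisj hB]
      rw [lintegral_tsum fun i => (K.measurable_coe (hB i)).aemeasurable, Set.preimage_iUnion,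
        measure_iUnion (fun i j hij => (hdisj hij).preimage e) fun i => he (hB i)]
      exact tsum_congr fun i => hG.lintegral_of_ae_tendsto (he (hB i)) (ih i)

/-- A measure-valued martingale on a standard Borel space converges setwise almost surely. -/
theorem exists_kernel_ae_tendsto [StandardBorelSpace Θ] (hG : IsMeasureMartingale P ℱ G₀ G) :
    ∃ K : Kernel Ω Θ, IsMarkovKernel K ∧
      ∀ A, MeasurableSet A → ∀ᵐ ω ∂P, Tendsto (fun n => G n ω A) atTop (𝓝 (K ω A)) := by
  classical
  have he := measurableEmbedding_embeddingReal Θ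
  set e := embeddingReal Θ
  have hF := hG.measurable_limitRatCDF he.measurable
  let L : Kernel Ω ℝ := ⟨fun ω => (stieltjesOfMeasurableRat _ hF ω).measure,
    measurable_measure_stieltjesOfMeasurableRat hF⟩
  have hL : IsMarkovKernel L :=
    ⟨fun ω => instIsProbabilityMeasure_stieltjesOfMeasurableRat hF ω⟩
  have hconv : ∀ B, MeasurableSet B →
      ∀ᵐ ω ∂P, Tendsto (fun n => G n ω (e ⁻¹' B)) atTop (𝓝 (L ω B)) := by
    intro B hB
    refine hG.ae_tendsto_of_tendsto_Iic he.measurable (fun q => ?_) hB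
    filter_upwards [hG.ae_isRatStieltjesPoint he.measurable,
      hG.ae_tendsto_limsup (he.measurable (measurableSet_Iic (a := (q : ℝ))))] with ω h1 h2
    have h3 : L ω (Set.Iic (q : ℝ)) = limsup (fun n => G n ω (e ⁻¹' Set.Iic (q : ℝ))) atTop := by
      change (stieltjesOfMeasurableRat _ hF ω).measure (Set.Iic (q : ℝ)) = _
      rw [measure_stieltjesOfMeasurableRat_Iic, stieltjesOfMeasurableRat_eq,
        toRatCDF_of_isRatStieltjesPoint h1]
      exact ENNReal.ofReal_toReal ((hG.limsup_le_one ω _).trans_lt ENNReal.one_lt_top).ne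
    rw [h3]
    exact h2
  have hrange : ∀ᵐ ω ∂P, L ω (Set.range e) = 1 := by
    filter_upwards [hconv _ he.measurableSet_range, hG.ae_univ_eq_one] with ω h h1
    rw [Set.preimage_range] at h
    simp_rw [h1] at h
    exact tendsto_nhds_unique h tendsto_const_nhds
  have hs : MeasurableSet {ω | L ω (Set.range e) = 1} :=
    L.measurable_coe he.measurableSet_range (measurableSet_singleton 1)
  -- On the null event where `L ω` does not give full mass to the range of `e`, its pullback would
  -- not be a probability measure; `G₀` is substituted there.
  refine ⟨Kernel.piecewise hs (L.comapRight he) (Kernel.const Ω G₀), ⟨fun ω => ?_⟩,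
    fun A hA => ?_⟩
  · rw [Kernel.piecewise_apply]
    split_ifs with h
    · refine ⟨?_⟩
      rw [Kernel.comapRight_apply' _ _ _ MeasurableSet.univ, Set.image_univ]
      exact h
    · rw [Kernel.const_apply]
      infer_instance
  · filter_upwards [hconv _ (he.measurableSet_image.2 hA), hrange] with ω h h1
    rw [Kernel.piecewise_apply, if_pos (show ω ∈ {ω | L ω (Set.range e) = 1} from h1),
      Kernel.comapRight_apply' _ _ _ hA]
    rwa [Set.preimage_image_eq _ he.injective] at h

/-- Setwise almost sure convergence implies almost sure weak convergence. -/
theorem ae_tendsto_integral [TopologicalSpace Θ] [TopologicalSpace.MetrizableSpace Θ]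
    [SecondCountableTopology Θ] [BorelSpace Θ] (hG : IsMeasureMartingale P ℱ G₀ G)
    {K : Kernel Ω Θ} [IsMarkovKernel K]
    (hK : ∀ A, MeasurableSet A → ∀ᵐ ω ∂P, Tendsto (fun n => G n ω A) atTop (𝓝 (K ω A))) :
    ∀ᵐ ω ∂P, ∀ h : Θ →ᵇ ℝ,
      Tendsto (fun n => ∫ t, h t ∂G n ω) atTop (𝓝 (∫ t, h t ∂K ω)) := by
  set S := TopologicalSpace.countableBasis Θ
  have hS := TopologicalSpace.isBasis_countableBasis Θ
  -- The exceptional null set depends on the event, so convergence is used only on finite unions of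
  -- basic open sets, a countable family.
  have hcount : {T : Set (Set Θ) | T.Finite ∧ T ⊆ S}.Countable :=
    Set.countable_ofPred_finite_subset (TopologicalSpace.countable_countableBasis Θ)
  have hfin : ∀ᵐ ω ∂P, ∀ T ∈ {T : Set (Set Θ) | T.Finite ∧ T ⊆ S},
      Tendsto (fun n => G n ω (⋃₀ T)) atTop (𝓝 (K ω (⋃₀ T))) :=
    (ae_ball_iff hcount).2 fun T hT =>
      hK _ (isOpen_sUnion fun s hs => hS.isOpen (hT.2 hs)).measurableSet
  filter_upwards [hfin, hG.ae_univ_eq_one] with ω hω h1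
  let ν : ProbabilityMeasure Θ := ⟨K ω, inferInstance⟩
  let νs : ℕ → ProbabilityMeasure Θ := fun n => ⟨G n ω, ⟨h1 n⟩⟩
  have key : Tendsto νs atTop (𝓝 ν) := by
    refine tendsto_of_forall_isOpen_le_liminf' fun U hU => ?_
    refine le_of_forall_lt fun r hr => ?_
    have hr' : r.toNNReal < ν U := by
      rw [← ENNReal.coe_lt_coe, ENNReal.coe_toNNReal (hr.trans_le le_top).ne]
      simpa using hr
    -- A finite union of basic sets inside `U` already has limiting mass above `r`, which gives the
    -- portmanteau lower bound.
    obtain ⟨T, hTS, hrT, hTU⟩ := ν.exists_lt_measure_biUnion_of_isOpen (S := S)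
      (fun u hu x hx => by
        obtain ⟨s, hs, hxs, hsu⟩ := hS.exists_subset_of_mem_open hx hu
        exact ⟨s, hs, (hS.isOpen hs).mem_nhds hxs, hsu⟩) hU hr'
    rw [← ENNReal.coe_lt_coe, ENNReal.coe_toNNReal (hr.trans_le le_top).ne] at hrT
    have hT := hω (T : Set (Set Θ)) ⟨T.finite_toSet, fun s hs => hTS s hs⟩
    have hT' : ⋃₀ (T : Set (Set Θ)) = ⋃ t ∈ T, t := by
      rw [Set.sUnion_eq_biUnion]; simp
    rw [hT'] at hT
    have hlt : r < K ω (⋃ t ∈ T, t) := by simpa [ν] using hrT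
    refine hlt.trans_le ?_
    rw [← hT.liminf_eq]
    exact liminf_le_liminf (Eventually.of_forall fun n => measure_mono hTU)
  exact ProbabilityMeasure.tendsto_iff_forall_integral_tendsto.1 key

end IsMeasureMartingale

/-! ### Continuity of the plug-in variance -/

/-- Dominated convergence with a convergent sequence of dominating functions of constant finite
integral. -/
theorem tendsto_lintegral_of_le_of_lintegral_eq {E : Type*} [MeasurableSpace E] {μ : Measure E}
    {b c : ℕ → E → ℝ≥0∞} {b' c' : E → ℝ≥0∞} {a : ℝ≥0∞} (ha : a ≠ ∞)
    (hb : ∀ n, Measurable (b n)) (hc : ∀ n, Measurable (c n)) (hc' : Measurable c')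
    (hcb : ∀ n x, c n x ≤ b n x) (hba : ∀ n, ∫⁻ x, b n x ∂μ = a) (hb'a : ∫⁻ x, b' x ∂μ = a)
    (hblim : ∀ᵐ x ∂μ, Tendsto (fun n => b n x) atTop (𝓝 (b' x)))
    (hclim : ∀ᵐ x ∂μ, Tendsto (fun n => c n x) atTop (𝓝 (c' x)))
    (hbfin : ∀ᵐ x ∂μ, b' x ≠ ∞) :
    Tendsto (fun n => ∫⁻ x, c n x ∂μ) atTop (𝓝 (∫⁻ x, c' x ∂μ)) := by
  have hc'b' : ∀ᵐ x ∂μ, c' x ≤ b' x := by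
    filter_upwards [hblim, hclim] with x h1 h2
    exact le_of_tendsto_of_tendsto' h2 h1 fun n => hcb n x
  have hcn : ∀ n, ∫⁻ x, c n x ∂μ ≤ a := fun n => (hba n) ▸ lintegral_mono (hcb n)
  have hc'a : ∫⁻ x, c' x ∂μ ≤ a := hb'a ▸ lintegral_mono_ae hc'b'
  have hsub : ∀ n, ∫⁻ x, b n x - c n x ∂μ = a - ∫⁻ x, c n x ∂μ := fun n => by
    rw [lintegral_sub (hc n) ((hcn n).trans_lt ha.lt_top).ne (Eventually.of_forall (hcb n)), hba]
  have hsub' : ∫⁻ x, b' x - c' x ∂μ = a - ∫⁻ x, c' x ∂μ := by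
    rw [lintegral_sub hc' (hc'a.trans_lt ha.lt_top).ne hc'b', hb'a]
  have hlow : ∫⁻ x, c' x ∂μ ≤ liminf (fun n => ∫⁻ x, c n x ∂μ) atTop := by
    refine le_trans (lintegral_congr_ae ?_).le (lintegral_liminf_le hc)
    filter_upwards [hclim] with x hx using hx.liminf_eq.symm
  -- Fatou applied to `b n - c n` bounds the upper limit of the integrals of `c n`; finiteness of
  -- `b'` makes the truncated subtraction continuous.
  have hup : a - ∫⁻ x, c' x ∂μ ≤ liminf (fun n => a - ∫⁻ x, c n x ∂μ) atTop := by
    simp_rw [← hsub, ← hsub']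
    refine le_trans (lintegral_congr_ae ?_).le (lintegral_liminf_le fun n => (hb n).sub (hc n))
    filter_upwards [hblim, hclim, hbfin] with x h1 h2 h3
    exact (ENNReal.Tendsto.sub h1 h2 (Or.inl h3)).liminf_eq.symm
  refine tendsto_of_le_liminf_of_limsup_le hlow ?_
  rw [ENNReal.liminf_const_sub atTop _ ha] at hup
  have hls : limsup (fun n => ∫⁻ x, c n x ∂μ) atTop ≤ a :=
    limsup_le_of_le (by isBoundedDefault) (Eventually.of_forall hcn)
  exact (ENNReal.sub_le_sub_iff_left hls ha).1 hup

/-- When `D' = 0` the ratios need not converge, but they are at most one, so the product is squeezed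
to zero by `D n`. This is why points with `f_G(x) = 0` cause no trouble. -/
theorem tendsto_mul_div_sq {N D : ℕ → ℝ≥0∞} {N' D' : ℝ≥0∞} (hN : Tendsto N atTop (𝓝 N'))
    (hD : Tendsto D atTop (𝓝 D')) (hND : ∀ n, N n ≤ D n) (hD' : D' ≠ ∞) :
    Tendsto (fun n => D n * (N n / D n) ^ 2) atTop (𝓝 (D' * (N' / D') ^ 2)) := by
  rcases eq_or_ne D' 0 with rfl | h0
  · rw [zero_mul]
    refine tendsto_of_tendsto_of_tendsto_of_le_of_le tendsto_const_nhds hD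
      (fun n => zero_le) fun n => ?_
    exact mul_le_of_le_one_right' (pow_le_one' (ENNReal.div_le_of_le_mul (by simpa using hND n)) 2)
  · have hN' : N' ≠ ∞ := ((le_of_tendsto_of_tendsto' hN hD hND).trans_lt hD'.lt_top).ne
    have hq : Tendsto (fun n => N n / D n) atTop (𝓝 (N' / D')) :=
      ENNReal.Tendsto.div hN (Or.inr h0) hD (Or.inr hN')
    exact ENNReal.Tendsto.mul hD (Or.inl h0) (ENNReal.Tendsto.pow hq) (Or.inr hD')

section Variance

variable {𝕏 Θ : Type*} [MeasurableSpace 𝕏] [MeasurableSpace Θ] {μ : Measure 𝕏}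
  {f : 𝕏 → Θ → ℝ≥0}

/-- Moves the varying measure `F_H` into the integrand, so that limits in `H` are taken under the
fixed measure `μ`. -/
theorem plugInVar_eq (hf : Measurable (Function.uncurry f)) (H : Measure Θ) [SFinite H]
    {A : Set Θ} (hA : MeasurableSet A) :
    plugInVar μ f H A
      = (∫⁻ x, mixDensity f H x * ((∫⁻ t in A, f x t ∂H) / mixDensity f H x) ^ 2 ∂μ).toReal
        - (H.real A) ^ 2 := by
  have hD := measurable_mixDensity_right hf H
  have hN : Measurable fun x => ∫⁻ t in A, f x t ∂H := measurable_mixDensity_right hf (H.restrict A)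
  have hp : Measurable fun x => ((∫⁻ t in A, f x t ∂H) / mixDensity f H x) ^ 2 :=
    (hN.div hD).pow_const 2
  have hle : ∀ x, (∫⁻ t in A, f x t ∂H) / mixDensity f H x ≤ 1 := fun x =>
    ENNReal.div_le_of_le_mul (by simpa using! setLIntegral_le_lintegral A _)
  rw [plugInVar]
  congr 1
  calc ∫ x, (posterior f H x).real A ^ 2 ∂mixture μ f H
      = ∫ x, (((∫⁻ t in A, f x t ∂H) / mixDensity f H x) ^ 2).toReal ∂mixture μ f H := by
        refine integral_congr_ae (Eventually.of_forall fun x => ?_)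
        simp only [Measure.real, posterior_apply _ _ _ hA, ENNReal.toReal_pow]
        rfl
    _ = _ := by
        rw [integral_toReal hp.aemeasurable (Eventually.of_forall fun x =>
          (pow_le_one' (hle x) 2).trans_lt ENNReal.one_lt_top), mixture,
          lintegral_withDensity_eq_lintegral_mul _ hD hp]
        rfl

theorem limitVar_eq_plugInVar (hf : Measurable (Function.uncurry f)) (H : Measure Θ) [SFinite H]
    (A : Set Θ) : limitVar μ f H A = plugInVar μ f H A := by
  rw [limitVar, plugInVar, Measure.restrict_eq_self_of_ae_mem]
  rw [mixture, ae_withDensity_iff (measurable_mixDensity_right hf H)]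
  exact Eventually.of_forall fun x hx => hx

/-- Continuity of the plug-in variance along measures for which the mixture density and its
restriction to `A` converge almost everywhere. -/
theorem tendsto_plugInVar [SigmaFinite μ] (hf : Measurable (Function.uncurry f))
    (hf1 : ∀ t, ∫⁻ x, (f x t : ℝ≥0∞) ∂μ = 1) {H : ℕ → Measure Θ}
    (hH : ∀ n, IsProbabilityMeasure (H n)) {K : Measure Θ} [IsProbabilityMeasure K]
    {A : Set Θ} (hA : MeasurableSet A) (hHA : Tendsto (fun n => H n A) atTop (𝓝 (K A)))
    (hD : ∀ᵐ x ∂μ, Tendsto (fun n => mixDensity f (H n) x) atTop (𝓝 (mixDensity f K x)))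
    (hN : ∀ᵐ x ∂μ, Tendsto (fun n => ∫⁻ t in A, f x t ∂H n) atTop (𝓝 (∫⁻ t in A, f x t ∂K))) :
    Tendsto (fun n => plugInVar μ f (H n) A) atTop (𝓝 (limitVar μ f K A)) := by
  have hDm := fun (L : Measure Θ) [SFinite L] => measurable_mixDensity_right hf L
  have hcm : ∀ (L : Measure Θ) [SFinite L], Measurable fun x =>
      mixDensity f L x * ((∫⁻ t in A, f x t ∂L) / mixDensity f L x) ^ 2 := fun L _ =>
    (hDm L).mul (((hDm (L.restrict A)).div (hDm L)).pow_const 2)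
  have hcb : ∀ (L : Measure Θ) (x : 𝕏),
      mixDensity f L x * ((∫⁻ t in A, f x t ∂L) / mixDensity f L x) ^ 2 ≤ mixDensity f L x :=
    fun L x => mul_le_of_le_one_right' (pow_le_one' (ENNReal.div_le_of_le_mul
      (by simpa using! setLIntegral_le_lintegral A _)) 2)
  have hmass : ∀ (L : Measure Θ) [IsProbabilityMeasure L], ∫⁻ x, mixDensity f L x ∂μ = 1 :=
    fun L _ => by rw [lintegral_mixDensity hf hf1, measure_univ]
  rw [limitVar_eq_plugInVar hf, plugInVar_eq hf K hA]
  simp_rw [fun n => plugInVar_eq (μ := μ) hf (H n) hA]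
  refine Tendsto.sub ?_ (((ENNReal.tendsto_toReal (measure_ne_top K A)).comp hHA).pow 2)
  have hfin : ∫⁻ x, mixDensity f K x * ((∫⁻ t in A, f x t ∂K) / mixDensity f K x) ^ 2 ∂μ ≠ ∞ :=
    (((lintegral_mono (hcb K)).trans (hmass K).le).trans_lt ENNReal.one_lt_top).ne
  refine (ENNReal.tendsto_toReal hfin).comp ?_
  have hKfin := ae_mixDensity_lt_top hf hf1 K
  refine tendsto_lintegral_of_le_of_lintegral_eq ENNReal.one_ne_top (fun n => hDm (H n))
    (fun n => hcm (H n)) (hcm K) (fun n => hcb (H n)) (fun n => hmass (H n)) (hmass K) hD ?_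
    (hKfin.mono fun x hx => hx.ne)
  filter_upwards [hD, hN, hKfin] with x h1 h2 h3
  exact tendsto_mul_div_sq h2 h1 (fun n => setLIntegral_le_lintegral A _) h3.ne

end Variance

/-! ### Convergence of the densities and conclusion for Newton's model -/

section Model

variable {Ω 𝕏 Θ : Type*} [mΩ : MeasurableSpace Ω] [MeasurableSpace 𝕏] [MeasurableSpace Θ]
  {P : Measure Ω} [IsProbabilityMeasure P] {μ : Measure 𝕏} [SigmaFinite μ]
  {f : 𝕏 → Θ → ℝ≥0} {α : ℕ → ℝ} {G₀ : Measure Θ} [IsProbabilityMeasure G₀]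
  {X : ℕ → Ω → 𝕏} {θ : ℕ → Ω → Θ}

theorem IsNewtonModel.isMeasureMartingale (hmodel : IsNewtonModel P μ f α G₀ X θ)
    (hf : Measurable (Function.uncurry f)) (hf1 : ∀ t, ∫⁻ x, (f x t : ℝ≥0∞) ∂μ = 1)
    (hα : ∀ n, 1 ≤ n → α n ∈ Set.Ioo (0 : ℝ) 1) :
    IsMeasureMartingale P ⟨past X, fun _ _ h => past_mono X h, past_le hmodel.measurable_X⟩ G₀
      (newtonAt f α G₀ X) where
  zero _ := rfl
  measurable_past := measurable_newtonAt hf hα prob_le_one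
  univ_le_one n _ := newton_univ_le_one hα prob_le_one _ n
  setLIntegral_succ n _ hC _ hg :=
    setLIntegral_lintegral_newtonAt_succ hf hf1 hα hmodel n hC hg

theorem IsMeasureMartingale.ae_ae_tendsto_setLIntegral_density {ℱ : Filtration ℕ mΩ}
    {G : ℕ → Ω → Measure Θ} (hG : IsMeasureMartingale P ℱ G₀ G)
    (hf : Measurable (Function.uncurry f)) (hf1 : ∀ t, ∫⁻ x, (f x t : ℝ≥0∞) ∂μ = 1)
    {K : Kernel Ω Θ} [IsMarkovKernel K]
    (hK : ∀ A, MeasurableSet A → ∀ᵐ ω ∂P, Tendsto (fun n => G n ω A) atTop (𝓝 (K ω A)))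
    {A : Set Θ} (hA : MeasurableSet A) :
    ∀ᵐ ω ∂P, ∀ᵐ x ∂μ, Tendsto (fun n => ∫⁻ t in A, f x t ∂G n ω) atTop
      (𝓝 (∫⁻ t in A, f x t ∂K ω)) := by
  have hu : ∀ n, Measurable fun p : Ω × 𝕏 => ∫⁻ t in A, f p.2 t ∂G n p.1 := fun n =>
    measurable_setLIntegral_density hf ((hG.measurable n).comp measurable_fst)
      (fun p => hG.univ_le_one n p.1) measurable_snd hA
  have hv : Measurable fun p : Ω × 𝕏 => ∫⁻ t in A, f p.2 t ∂K p.1 :=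
    measurable_setLIntegral_density hf (K.measurable.comp measurable_fst)
      (fun p => (prob_le_one : K p.1 Set.univ ≤ 1)) measurable_snd hA
  have hset : MeasurableSet {p : Ω × 𝕏 | Tendsto (fun n => ∫⁻ t in A, f p.2 t ∂G n p.1) atTop
      (𝓝 (∫⁻ t in A, f p.2 t ∂K p.1))} := by
    have h1 := measurableSet_eq_fun (Measurable.liminf hu) hv
    have h2 := measurableSet_eq_fun (Measurable.limsup hu) hv
    convert h1.inter h2 using 1
    ext p
    exact ⟨fun h => ⟨h.liminf_eq, h.limsup_eq⟩,
      fun h => tendsto_of_liminf_eq_limsup h.1 h.2⟩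
  -- The martingale argument works for fixed `x`, outside an event depending on `x`; Fubini
  -- exchanges the two almost-everywhere quantifiers.
  rw [Measure.ae_ae_comm hset]
  filter_upwards [ae_mixDensity_lt_top hf hf1 G₀] with x hx
  simp_rw [← lintegral_indicator hA]
  refine hG.ae_tendsto_lintegral hK ((measurable_density_section hf x).indicator hA) ?_
  rw [lintegral_indicator hA]
  exact ((setLIntegral_le_lintegral A _).trans_lt hx).ne

end Model

end NewtonMixture

theorem mainTheorem11 {Ω 𝕏 Θ : Type*} [MeasurableSpace Ω]
    [MeasurableSpace 𝕏] [StandardBorelSpace 𝕏]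
    [TopologicalSpace Θ] [TopologicalSpace.MetrizableSpace Θ] [SecondCountableTopology Θ]
    [MeasurableSpace Θ] [BorelSpace Θ] [StandardBorelSpace Θ]
    (P : Measure Ω) [IsProbabilityMeasure P]
    (μ : Measure 𝕏) [SigmaFinite μ]
    (f : 𝕏 → Θ → ℝ≥0) (hf_meas : Measurable (Function.uncurry f))
    (hf_density : ∀ t, ∫⁻ x, (f x t : ℝ≥0∞) ∂μ = 1)
    (α : ℕ → ℝ) (hα : ∀ n, 1 ≤ n → α n ∈ Set.Ioo (0 : ℝ) 1)
    (G₀ : Measure Θ) [IsProbabilityMeasure G₀]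
    (X : ℕ → Ω → 𝕏) (θ : ℕ → Ω → Θ)
    (hmodel : NewtonMixture.IsNewtonModel P μ f α G₀ X θ) :
    (∃ G : Kernel Ω Θ, IsMarkovKernel G ∧ NewtonMixture.IsWeakLimit P f α G₀ X G) ∧
    ∀ G : Kernel Ω Θ, IsMarkovKernel G → NewtonMixture.IsWeakLimit P f α G₀ X G →
      ∀ A : Set Θ, MeasurableSet A →
        ∀ᵐ ω ∂P,
          Tendsto (fun n => NewtonMixture.plugInVar μ f (NewtonMixture.newtonAt f α G₀ X n ω) A)
            atTop (𝓝 (NewtonMixture.limitVar μ f (G ω) A)) := by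
  have hG := hmodel.isMeasureMartingale hf_meas hf_density hα
  obtain ⟨K, hKm, hK⟩ := hG.exists_kernel_ae_tendsto
  have hweak := hG.ae_tendsto_integral hK
  refine ⟨⟨K, hKm, hweak⟩, fun G hGm hGlim A hA => ?_⟩
  have hN := hG.ae_ae_tendsto_setLIntegral_density hf_meas hf_density hK hA
  have hD := hG.ae_ae_tendsto_setLIntegral_density hf_meas hf_density hK MeasurableSet.univ
  filter_upwards [hweak, hGlim, hG.ae_univ_eq_one, hK A hA, hN, hD]
    with ω hKω hGω h1 hAω hNω hDω
  -- Bounded continuous functions separate finite measures, so the given weak limit inherits the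
  -- setwise and density limits proved for `K`.
  have hGK : G ω = K ω := ext_of_forall_integral_eq_of_IsFiniteMeasure fun h =>
    tendsto_nhds_unique (hGω h) (hKω h)
  rw [hGK]
  simp_rw [setLIntegral_univ] at hDω
  exact NewtonMixture.tendsto_plugInVar hf_meas hf_density (fun n => ⟨h1 n⟩) hA hAω hDω hNω
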